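/- Let $H$ be a finite forest and let $s>0$ be an integer. Then there exists a real number $c>0$ such that for every finite simple graph $G$ and every integer $t>0$: if $G$ is $H$-free (no induced subgraph of $G$ is isomorphic to $H$) and $G$ does not contain the complete bipartite graph $K_{s,t}$ as a (not necessarily induced) subgraph, then $\partial(G)<ct$. Here $\partial(G)$, the degeneracy of $G$, is the smallest integer $d\ge 0$ such that every nonnull subgraph of $G$ has a vertex of degree at most $d$ in that subgraph. -/

import Mathlib

namespace SimpleGraph

/-- A graph is `d`-degenerate if every nonnull subgraph (not necessarily induced) has a vertex
whose degree in that subgraph is at most `d`. -/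
def IsDegenerate {V : Type*} (G : SimpleGraph V) (d : ℕ) : Prop :=
  ∀ K : G.Subgraph, K.verts.Nonempty → ∃ v ∈ K.verts, (K.neighborSet v).encard ≤ d

/-- The degeneracy of a finite graph: the smallest `d` such that the graph is `d`-degenerate.
Such a `d` exists for every finite graph, by `isDegenerate_card` below. -/
noncomputable def degeneracy {V : Type*} (G : SimpleGraph V) : ℕ :=
  sInf {d : ℕ | G.IsDegenerate d}

theorem isDegenerate_card {V : Type*} [Finite V] (G : SimpleGraph V) :
    G.IsDegenerate (Nat.card V) := by
  rintro K ⟨v, hv⟩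
  refine ⟨v, hv, (Set.encard_le_encard (Set.subset_univ _)).trans ?_⟩
  rw [Set.encard_univ, ENat.card_eq_coe_natCard]

theorem isDegenerate_degeneracy {V : Type*} [Finite V] (G : SimpleGraph V) :
    G.IsDegenerate G.degeneracy :=
  Nat.sInf_mem (s := {d : ℕ | G.IsDegenerate d}) ⟨_, G.isDegenerate_card⟩

end SimpleGraph

/-! If the degeneracy is at least `c * t`, some induced subgraph has minimum degree at least `d = c
* t`. Map `H` into it at random, by a stationary random walk indexed by a tree containing `H`: edges
go to edges automatically. Two failures remain. Two vertices collide with probability at most `1/d`.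
A non-edge becomes an edge rarely, because without `K_{s,t}` at most `m` vertices see a `δ` fraction
of any given neighbourhood (`card_lt_of_dense_to`). For `c` large in terms of `s` and `|H|` alone, a
union bound over pairs leaves an outcome with no failure, an induced copy of `H`. -/

namespace SimpleGraph

open Finset

/-! ### Leaves of forests. -/

section Leaf

variable {W : Type*} {H : SimpleGraph W}

theorem IsAcyclic.exists_subsingleton_neighborSet [Finite W] [Nonempty W] (hH : H.IsAcyclic) :
    ∃ k, (H.neighborSet k).Subsingleton := by
  classical
  have := Fintype.ofFinite W
  let P : ℕ → Prop := fun n => ∃ (u v : W) (p : H.Walk u v), p.IsPath ∧ p.length = n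
  have h0 : P 0 := ⟨Classical.arbitrary W, _, .nil, .nil, rfl⟩
  -- A longest path: a neighbour of its start off the path would extend it.
  obtain ⟨u, v, p, hp, hlen⟩ : P (Nat.findGreatest P (Fintype.card W)) :=
    Nat.findGreatest_spec (Nat.zero_le _) h0
  have key : ∀ a, H.Adj u a → a = p.snd := by
    intro a ha
    refine hH.eq_snd_of_adj_start hp ha ?_
    by_contra hmem
    have hq : (Walk.cons ha.symm p).IsPath := hp.cons hmem
    have := Nat.le_findGreatest (P := P) hq.length_lt.le ⟨_, _, _, hq, rfl⟩
    rw [Walk.length_cons] at this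
    omega
  exact ⟨u, fun a ha b hb => (key a ha).trans (key b hb).symm⟩

theorem IsAcyclic.exists_mem_subsingleton_neighborSet_inter (hH : H.IsAcyclic) {S : Finset W}
    (hS : S.Nonempty) : ∃ k ∈ S, (H.neighborSet k ∩ S).Subsingleton := by
  have : Nonempty (S : Set W) := hS.to_subtype
  obtain ⟨k, hk⟩ := (hH.induce (S : Set W)).exists_subsingleton_neighborSet
  refine ⟨k, k.2, fun a ha b hb => ?_⟩
  have := @hk ⟨a, ha.2⟩ ha.1 ⟨b, hb.2⟩ hb.1
  simpa using this

end Leaf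

/-! ### Double counting without `K_{s,t}`. -/

section Biclique

variable {V : Type*} {G : SimpleGraph V}

theorem completeBipartiteGraph_isContained_of_finset {s t : ℕ} {A B : Finset V}
    (hA : #A = s) (hB : t ≤ #B) (hAB : ∀ a ∈ A, ∀ b ∈ B, G.Adj a b) :
    (completeBipartiteGraph (Fin s) (Fin t)).IsContained G := by
  obtain ⟨B', hB', hcard⟩ := exists_subset_card_eq hB
  let f : Fin s ↪ V := (A.equivFinOfCardEq hA).symm.toEmbedding.trans (.subtype _)
  let g : Fin t ↪ V := (B'.equivFinOfCardEq hcard).symm.toEmbedding.trans (.subtype _)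
  have hf : ∀ i, f i ∈ A := fun i => ((A.equivFinOfCardEq hA).symm i).2
  have hg : ∀ i, g i ∈ B := fun i => hB' ((B'.equivFinOfCardEq hcard).symm i).2
  refine ⟨⟨⟨Sum.elim f g, ?_⟩, ?_⟩⟩
  · rintro (i | i) (j | j) h
    · simp at h
    · exact hAB _ (hf i) _ (hg j)
    · exact (hAB _ (hf j) _ (hg i)).symm
    · simp at h
  · exact f.injective.sumElim g.injective fun i j => (hAB _ (hf i) _ (hg j)).ne

variable [DecidableEq V] [DecidableRel G.Adj]

/-- In a graph without `K_{s,t}`, few vertices see a constant proportion of a large set. -/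
theorem card_lt_of_dense_to {s t m : ℕ} (hs : 0 < s)
    (hG : ¬ (completeBipartiteGraph (Fin s) (Fin t)).IsContained G) {δ : ℝ}
    (hm : 2 * s ≤ δ * m) {X U : Finset V} (hX : m * 2 ^ m * t < #X)
    (hU : ∀ u ∈ U, δ * #X ≤ #{x ∈ X | G.Adj u x}) : #U < m := by
  by_contra! hmU
  obtain ⟨U', hU'U, hcard⟩ := exists_subset_card_eq hmU
  -- Each `s`-subset of `U'` has fewer than `t` common neighbours in `X`, so `B` is small; a point
  -- outside `B` receives fewer than `s` edges from `U'`.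
  set B := {x ∈ X | s ≤ #{u ∈ U' | G.Adj u x}}
  have hB : #B ≤ 2 ^ m * t := by
    have hsub : B ⊆ (powersetCard s U').biUnion fun A => {x ∈ X | ∀ a ∈ A, G.Adj a x} := by
      intro x hx
      obtain ⟨hxX, hx⟩ := mem_filter.1 hx
      obtain ⟨A, hA, hAs⟩ := exists_subset_card_eq hx
      refine mem_biUnion.2 ⟨A, mem_powersetCard.2 ⟨hA.trans (filter_subset _ _), hAs⟩, ?_⟩
      exact mem_filter.2 ⟨hxX, fun a ha => (mem_filter.1 (hA ha)).2⟩
    calc #B ≤ _ := card_le_card hsub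
      _ ≤ #(powersetCard s U') * t := by
        refine card_biUnion_le_card_mul _ _ _ fun A hA => ?_
        by_contra! h
        exact hG (completeBipartiteGraph_isContained_of_finset (mem_powersetCard.1 hA).2 h.le
          fun a ha b hb => (mem_filter.1 hb).2 a ha)
      _ ≤ 2 ^ m * t := by
        rw [card_powersetCard, hcard]
        gcongr
        exact Nat.choose_le_two_pow m s
  have hcount : ∑ u ∈ U', #{x ∈ X | G.Adj u x} ≤ s * #X + m * #B := by
    have := sum_card_bipartiteAbove_eq_sum_card_bipartiteBelow (s := U') (t := X) G.Adj
    simp only [bipartiteAbove, bipartiteBelow] at this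
    rw [this]
    calc ∑ x ∈ X, #{u ∈ U' | G.Adj u x}
        ≤ ∑ x ∈ X, (s + if s ≤ #{u ∈ U' | G.Adj u x} then m else 0) := by
          refine sum_le_sum fun x _ => ?_
          split_ifs with h
          · exact (card_filter_le _ _).trans (by omega)
          · omega
      _ = s * #X + m * #B := by
          rw [sum_add_distrib, ← sum_filter, sum_const, sum_const, smul_eq_mul, smul_eq_mul,
            mul_comm, mul_comm #B]
  have hlow : δ * m * #X ≤ ∑ u ∈ U', (#{x ∈ X | G.Adj u x} : ℝ) := by
    calc δ * m * #X = ∑ u ∈ U', δ * (#X : ℝ) := by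
          rw [sum_const, hcard, nsmul_eq_mul]; ring
      _ ≤ _ := sum_le_sum fun u hu => hU u (hU'U hu)
  have hcount' : ∑ u ∈ U', (#{x ∈ X | G.Adj u x} : ℝ) ≤ s * #X + m * #B := by
    exact_mod_cast hcount
  have hmB : (m * #B : ℝ) < #X := by
    have : m * #B < #X := (Nat.mul_le_mul_left m hB).trans_lt (by rwa [← mul_assoc])
    exact_mod_cast this
  have hsX : (#X : ℝ) ≤ s * #X :=
    le_mul_of_one_le_left (Nat.cast_nonneg _) (by exact_mod_cast hs)
  have := mul_le_mul_of_nonneg_right hm (Nat.cast_nonneg (α := ℝ) #X)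
  linarith

end Biclique

/-! ### Random walks indexed by trees. -/

section TreeWalk

universe u v

variable {W : Type u} {V : Type v} [Fintype V]

/-- The transition matrix of the simple random walk. -/
noncomputable def walkKernel (G : SimpleGraph V) [DecidableRel G.Adj] (a b : V) : ℝ :=
  if G.Adj a b then (G.degree a : ℝ)⁻¹ else 0

/-- A finite weighted family of maps `Option W → V` that behaves like the stationary random walk
on `G` indexed by a tree on `S ∪ {none}` containing the forest `H[S]`. Weights are not normalized:
the stationary measure of a vertex is its degree. -/
structure TreeWalk (H : SimpleGraph W) (G : SimpleGraph V) [DecidableRel G.Adj] (d ε : ℝ)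
    (S : Finset W) where
  Ω : Type v
  [fintype : Fintype Ω]
  weight : Ω → ℝ
  weight_nonneg : ∀ ω, 0 ≤ weight ω
  map : Ω → Option W → V
  marginal : ∀ i ∈ insertNone S, ∀ f : V → ℝ,
    ∑ ω, weight ω * f (map ω i) = ∑ a, G.degree a * f a
  -- Given the image of `j`, each value of the image of `i` has conditional probability at most
  -- `1/d`.
  joint : ∀ i ∈ insertNone S, ∀ j ∈ insertNone S, i ≠ j → ∀ f : V → V → ℝ, (∀ a b, 0 ≤ f a b) →
    ∑ ω, weight ω * f (map ω i) (map ω j) ≤ d⁻¹ * ∑ a, ∑ b, G.degree b * f a b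
  adj : ∀ i ∈ S, ∀ j ∈ S, H.Adj i j → ∀ ω, weight ω ≠ 0 → G.Adj (map ω i) (map ω j)
  not_adj : ∀ i ∈ S, ∀ j ∈ S, i ≠ j → ¬ H.Adj i j →
    ∑ ω, weight ω * (if G.Adj (map ω i) (map ω j) then 1 else 0) ≤ ε * ∑ a, (G.degree a : ℝ)

attribute [instance] TreeWalk.fintype

variable {H : SimpleGraph W} {G : SimpleGraph V} [DecidableRel G.Adj] {d ε : ℝ} {S : Finset W}

theorem walkKernel_nonneg (a b : V) : 0 ≤ G.walkKernel a b := by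
  unfold walkKernel; split_ifs <;> positivity

theorem degree_mul_walkKernel (a b : V) :
    G.degree a * G.walkKernel a b = if G.Adj a b then 1 else 0 := by
  unfold walkKernel
  split_ifs with h
  · exact mul_inv_cancel₀ (Nat.cast_ne_zero.2 (G.degree_pos_iff_exists_adj a |>.2 ⟨b, h⟩).ne')
  · simp

theorem walkKernel_le (hd : 0 < d) (hG : ∀ a, d ≤ G.degree a) (a b : V) :
    G.walkKernel a b ≤ d⁻¹ := by
  unfold walkKernel
  split_ifs
  · exact inv_anti₀ hd (hG a)
  · positivity

theorem sum_ite_adj (a : V) : ∑ b, (if G.Adj a b then (1 : ℝ) else 0) = G.degree a := by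
  rw [sum_boole, ← card_neighborFinset_eq_degree, neighborFinset_eq_filter]

theorem sum_degree_mul_walkKernel (f : V → ℝ) :
    ∑ a, G.degree a * ∑ b, G.walkKernel a b * f b = ∑ b, G.degree b * f b := by
  simp_rw [mul_sum, ← mul_assoc, degree_mul_walkKernel]
  rw [sum_comm]
  simp_rw [← sum_mul]
  refine sum_congr rfl fun b _ => ?_
  rw [← sum_ite_adj]
  simp_rw [G.adj_comm]

theorem sum_walkKernel_mul_le (hd : 0 < d) (hG : ∀ a, d ≤ G.degree a) {f : V → ℝ}
    (hf : ∀ a, 0 ≤ f a) (a : V) : ∑ b, G.walkKernel a b * f b ≤ d⁻¹ * ∑ b, f b := by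
  rw [mul_sum]
  exact sum_le_sum fun b _ => mul_le_mul_of_nonneg_right (walkKernel_le hd hG a b) (hf b)

/-- The walk consisting of a single stationary vertex. -/
def TreeWalk.single (H : SimpleGraph W) (G : SimpleGraph V) [DecidableRel G.Adj] (d ε : ℝ) :
    TreeWalk H G d ε ∅ where
  Ω := V
  weight v := G.degree v
  weight_nonneg _ := Nat.cast_nonneg _
  map v _ := v
  marginal _ _ _ := rfl
  joint i hi j hj hij := by
    cases i <;> cases j <;> simp_all
  adj _ hi := by simp at hi
  not_adj _ hi := by simp at hi

/-- A random neighbour of `c` is adjacent to `a` with probability at most `δ`, unless `a` is one of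
the at most `m` vertices heavy for `c`; by `joint` that exception costs at most `m / d`. -/
theorem TreeWalk.sum_walkKernel_adj_le (T : TreeWalk H G d ε S) (hd : 0 < d)
    {δ : ℝ} {m : ℕ} (hε : δ + m / d ≤ ε)
    (hheavy : ∀ c, #{a | δ * G.degree c ≤ #{x ∈ G.neighborFinset c | G.Adj a x}} ≤ m)
    {i p : Option W} (hi : i ∈ insertNone S) (hp : p ∈ insertNone S) (hip : i ≠ p) (hδ : 0 ≤ δ) :
    ∑ ω, T.weight ω * ∑ b, G.walkKernel (T.map ω p) b *
      (if G.Adj (T.map ω i) b then 1 else 0) ≤ ε * ∑ a, (G.degree a : ℝ) := by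
  let f : V → V → ℝ := fun a c =>
    if δ * G.degree c ≤ #{x ∈ G.neighborFinset c | G.Adj a x} then 1 else 0
  have hf : ∀ a c, 0 ≤ f a c := fun a c => by dsimp only [f]; split_ifs <;> norm_num
  have hstep : ∀ a c, ∑ b, G.walkKernel c b * (if G.Adj a b then 1 else 0) ≤ δ + f a c := by
    intro a c
    have h1 : ∑ b, G.walkKernel c b * (if G.Adj a b then 1 else 0) =
        (G.degree c : ℝ)⁻¹ * #{x ∈ G.neighborFinset c | G.Adj a x} := by
      rw [neighborFinset_eq_filter, filter_filter, ← sum_boole, mul_sum]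
      refine sum_congr rfl fun b _ => ?_
      unfold walkKernel
      by_cases h : G.Adj c b <;> by_cases h' : G.Adj a b <;> simp [h, h']
    have h2 : (#{x ∈ G.neighborFinset c | G.Adj a x} : ℝ) ≤ G.degree c := by
      rw [← card_neighborFinset_eq_degree]
      exact_mod_cast card_filter_le _ _
    rw [h1]
    rcases (Nat.cast_nonneg (α := ℝ) (G.degree c)).eq_or_lt with h0 | h0
    · rw [← h0]; simp only [inv_zero, zero_mul]; exact add_nonneg hδ (hf a c)
    rw [inv_mul_le_iff₀ h0]
    dsimp only [f]
    split_ifs with h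
    · nlinarith
    · rw [add_zero, mul_comm]; exact (not_le.1 h).le
  calc _ ≤ ∑ ω, T.weight ω * (δ + f (T.map ω i) (T.map ω p)) :=
        sum_le_sum fun ω _ => mul_le_mul_of_nonneg_left (hstep _ _) (T.weight_nonneg ω)
    _ = ∑ ω, T.weight ω * δ + ∑ ω, T.weight ω * f (T.map ω i) (T.map ω p) := by
        simp_rw [mul_add, sum_add_distrib]
    _ ≤ δ * ∑ a, (G.degree a : ℝ) + d⁻¹ * ∑ a, ∑ b, G.degree b * f a b := by
        refine add_le_add ?_ (T.joint i hi p hp hip f hf)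
        rw [T.marginal i hi fun _ => δ, ← sum_mul, mul_comm]
    _ ≤ δ * ∑ a, (G.degree a : ℝ) + d⁻¹ * ∑ b, G.degree b * (m : ℝ) := by
        rw [sum_comm]
        gcongr 2
        refine sum_le_sum fun b _ => ?_
        rw [← mul_sum, sum_boole]
        gcongr
        exact hheavy b
    _ = (δ + m / d) * ∑ a, (G.degree a : ℝ) := by
        rw [← sum_mul]; ring
    _ ≤ _ := by gcongr

/-- Extend a tree walk by a uniformly random neighbour of the vertex indexed by `p`. -/
theorem TreeWalk.extend [DecidableEq W] (T : TreeWalk H G d ε S) (hd : 0 < d)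
    (hG : ∀ a, d ≤ G.degree a) {δ : ℝ} (hδ : 0 ≤ δ) {m : ℕ} (hε : δ + m / d ≤ ε)
    (hheavy : ∀ c, #{a | δ * G.degree c ≤ #{x ∈ G.neighborFinset c | G.Adj a x}} ≤ m)
    {k : W} (hk : k ∉ S) {p : Option W} (hp : p ∈ insertNone S)
    (hadj : ∀ i ∈ S, H.Adj i k ↔ some i = p) : Nonempty (TreeWalk H G d ε (insert k S)) := by
  let map' : T.Ω × V → Option W → V := fun ω i => if i = some k then ω.2 else T.map ω.1 i
  have hmem : ∀ i ∈ insertNone (insert k S), i = some k ∨ i ≠ some k ∧ i ∈ insertNone S := by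
    rintro (_ | i) hi
    · simp
    · simp only [some_mem_insertNone, mem_insert, Option.some.injEq] at hi ⊢
      by_cases h : i = k <;> simp_all
  have hmemS : ∀ i ∈ insert k S, i = k ∨ i ≠ k ∧ i ∈ S := by
    intro i hi
    by_cases h : i = k <;> simp_all
  have hmapk : ∀ ω, map' ω (some k) = ω.2 := fun ω => if_pos rfl
  have hmap : ∀ {i}, i ≠ some k → ∀ ω, map' ω i = T.map ω.1 i := fun h ω => if_neg h
  have hsome : ∀ {i : W}, i ≠ k → some i ≠ some k := fun h => by simpa using h
  have hsum : ∀ F : T.Ω → V → ℝ,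
      ∑ ω : T.Ω × V, T.weight ω.1 * G.walkKernel (T.map ω.1 p) ω.2 * F ω.1 ω.2 =
        ∑ ω, T.weight ω * ∑ b, G.walkKernel (T.map ω p) b * F ω b := by
    intro F
    rw [Fintype.sum_prod_type]
    simp_rw [mul_sum, mul_assoc]
  have hnone : ∀ ω, ∑ b, G.walkKernel (T.map ω p) b = 1 := by
    intro ω
    have hpos : (G.degree (T.map ω p) : ℝ) ≠ 0 := (hd.trans_le (hG _)).ne'
    refine mul_left_cancel₀ hpos ?_
    simp_rw [mul_sum, degree_mul_walkKernel, sum_ite_adj, mul_one]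
  have hold : ∀ F : T.Ω → ℝ,
      ∑ ω : T.Ω × V, T.weight ω.1 * G.walkKernel (T.map ω.1 p) ω.2 * F ω.1 =
        ∑ ω, T.weight ω * F ω := by
    intro F
    rw [hsum fun ω _ => F ω]
    simp_rw [← sum_mul, hnone, one_mul]
  have hnewAdj : ∀ i ∈ S, ¬ H.Adj i k →
      ∑ ω : T.Ω × V, T.weight ω.1 * G.walkKernel (T.map ω.1 p) ω.2 *
        (if G.Adj (T.map ω.1 (some i)) ω.2 then 1 else 0) ≤ ε * ∑ a, (G.degree a : ℝ) := by
    intro i hi hik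
    rw [hsum fun ω b => if G.Adj (T.map ω (some i)) b then 1 else 0]
    exact T.sum_walkKernel_adj_le hd hε hheavy (some_mem_insertNone.2 hi) hp
      (fun h => hik ((hadj i hi).2 h)) hδ
  have hsupp : ∀ ω : T.Ω × V, T.weight ω.1 * G.walkKernel (T.map ω.1 p) ω.2 ≠ 0 →
      T.weight ω.1 ≠ 0 ∧ G.Adj (T.map ω.1 p) ω.2 := by
    intro ω h
    refine ⟨left_ne_zero_of_mul h, ?_⟩
    by_contra h'
    exact right_ne_zero_of_mul h (if_neg h')
  refine ⟨{
    Ω := T.Ω × V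
    weight := fun ω => T.weight ω.1 * G.walkKernel (T.map ω.1 p) ω.2
    weight_nonneg := fun ω => mul_nonneg (T.weight_nonneg _) (walkKernel_nonneg _ _)
    map := map'
    marginal := ?_
    joint := ?_
    adj := ?_
    not_adj := ?_ }⟩
  · intro i hi f
    rcases hmem i hi with rfl | ⟨hik, hi⟩
    · simp_rw [hmapk]
      rw [hsum fun _ b => f b, T.marginal p hp fun a => ∑ b, G.walkKernel a b * f b,
        sum_degree_mul_walkKernel]
    · simp_rw [hmap hik]
      rw [hold fun ω => f (T.map ω i), T.marginal i hi]
  · intro i hi j hj hij f hf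
    rcases hmem i hi with rfl | ⟨hik, hi⟩ <;> rcases hmem j hj with rfl | ⟨hjk, hj⟩
    · exact absurd rfl hij
    · simp_rw [hmapk, hmap hjk]
      rw [hsum fun ω b => f b (T.map ω j)]
      calc _ ≤ ∑ ω, T.weight ω * (d⁻¹ * ∑ b, f b (T.map ω j)) :=
            sum_le_sum fun ω _ => mul_le_mul_of_nonneg_left
              (sum_walkKernel_mul_le hd hG (fun b => hf b _) _) (T.weight_nonneg ω)
        _ = _ := by
            rw [T.marginal j hj fun c => d⁻¹ * ∑ b, f b c, sum_comm, mul_sum]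
            refine sum_congr rfl fun c _ => ?_
            rw [← mul_sum]; ring
    · simp_rw [hmapk, hmap hik]
      rw [hsum fun ω b => f (T.map ω i) b]
      by_cases hip : i = p
      · subst hip
        -- Parent and child: each adjacent pair has weight 1, at most `d⁻¹ * deg b`.
        rw [T.marginal i hi fun a => ∑ b, G.walkKernel a b * f a b, mul_sum]
        refine sum_le_sum fun a _ => ?_
        rw [mul_sum, mul_sum]
        refine sum_le_sum fun b _ => ?_
        rw [← mul_assoc, degree_mul_walkKernel, ← mul_assoc]
        refine mul_le_mul_of_nonneg_right ?_ (hf a b)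
        have : 1 ≤ d⁻¹ * G.degree b := by
          rw [inv_mul_eq_div, one_le_div hd]; exact hG b
        split_ifs
        · exact this
        · linarith
      -- Average over the last step, then use stationarity of the degree measure.
      · refine (T.joint i hi p hp hip (fun a c => ∑ b, G.walkKernel c b * f a b) fun a c =>
          sum_nonneg fun b _ => mul_nonneg (walkKernel_nonneg _ _) (hf _ _)).trans_eq ?_
        simp_rw [sum_degree_mul_walkKernel]
    · simp_rw [hmap hik, hmap hjk]
      rw [hold fun ω => f (T.map ω i) (T.map ω j)]
      exact T.joint i hi j hj hij f hf
  · intro i hi j hj hij ω hω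
    obtain ⟨hω1, hω2⟩ := hsupp ω hω
    rcases hmemS i hi with rfl | ⟨hik, hi'⟩ <;> rcases hmemS j hj with rfl | ⟨hjk, hj'⟩
    · exact absurd hij (H.irrefl)
    · rw [hmapk, hmap (hsome hjk), (hadj j hj').1 hij.symm]
      exact hω2.symm
    · rw [hmapk, hmap (hsome hik), (hadj i hi').1 hij]
      exact hω2
    · rw [hmap (hsome hik), hmap (hsome hjk)]
      exact T.adj i hi' j hj' hij _ hω1
  · intro i hi j hj hij hnadj
    rcases hmemS i hi with rfl | ⟨hik, hi'⟩ <;> rcases hmemS j hj with rfl | ⟨hjk, hj'⟩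
    · exact absurd rfl hij
    · simp_rw [hmapk, hmap (hsome hjk), G.adj_comm _ (T.map _ _)]
      exact hnewAdj j hj' fun h => hnadj h.symm
    · simp_rw [hmapk, hmap (hsome hik)]
      exact hnewAdj i hi' hnadj
    · simp_rw [hmap (hsome hik), hmap (hsome hjk)]
      rw [hold fun ω => if G.Adj (T.map ω (some i)) (T.map ω (some j)) then 1 else 0]
      exact T.not_adj i hi' j hj' hij hnadj

theorem IsAcyclic.nonempty_treeWalk (hH : H.IsAcyclic) (hd : 0 < d)
    (hG : ∀ a, d ≤ G.degree a) {δ : ℝ} (hδ : 0 ≤ δ) {m : ℕ} (hε : δ + m / d ≤ ε)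
    (hheavy : ∀ c, #{a | δ * G.degree c ≤ #{x ∈ G.neighborFinset c | G.Adj a x}} ≤ m)
    (S : Finset W) : Nonempty (TreeWalk H G d ε S) := by
  classical
  induction hn : #S generalizing S with
  | zero => rw [card_eq_zero.1 hn]; exact ⟨.single H G d ε⟩
  | succ n ih =>
    obtain ⟨k, hkS, hk⟩ := hH.exists_mem_subsingleton_neighborSet_inter (S := S)
      (card_pos.1 (by omega))
    obtain ⟨T⟩ := ih (S.erase k) (by rw [card_erase_of_mem hkS]; omega)
    rw [← insert_erase hkS]
    by_cases h : ∃ q ∈ S.erase k, H.Adj q k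
    · obtain ⟨q, hq, hqk⟩ := h
      refine T.extend hd hG hδ hε hheavy (notMem_erase k S) (some_mem_insertNone.2 hq) fun i hi => ?_
      rw [Option.some_inj]
      exact ⟨fun hik => hk ⟨hik.symm, mem_of_mem_erase hi⟩ ⟨hqk.symm, mem_of_mem_erase hq⟩,
        fun h => h ▸ hqk⟩
    -- With no neighbour left in `S`, `k` hangs from the auxiliary root `none`, which carries no
    -- adjacency condition.
    · push Not at h
      exact T.extend hd hG hδ hε hheavy (notMem_erase k S) (none_mem_insertNone) fun i hi =>
        ⟨fun hik => absurd hik (h i hi), fun h => by cases h⟩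

theorem TreeWalk.isIndContained [Fintype W] [Nonempty V] (T : TreeWalk H G d ε univ) (hd : 0 < d)
    (hG : ∀ a, d ≤ G.degree a) (hε : 0 ≤ ε)
    (hsmall : (Fintype.card W : ℝ) ^ 2 * (d⁻¹ + ε) < 1) : H.IsIndContained G := by
  classical
  set D : ℝ := ∑ a, (G.degree a : ℝ) with hD
  have hDpos : 0 < D := sum_pos (fun a _ => hd.trans_le (hG a)) univ_nonempty
  -- Counts collisions and spurious edges; a total below 1 rules out both.
  let bad : T.Ω → W × W → ℝ := fun ω q =>
    if q.1 = q.2 then 0 else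
      (if T.map ω (some q.1) = T.map ω (some q.2) then 1 else 0) +
        (if H.Adj q.1 q.2 then 0
          else if G.Adj (T.map ω (some q.1)) (T.map ω (some q.2)) then 1 else 0)
  have hmem : ∀ i, some i ∈ insertNone (univ : Finset W) := fun i => by simp
  have hbad : ∀ q, ∑ ω, T.weight ω * bad ω q ≤ (d⁻¹ + ε) * D := by
    rintro ⟨i, j⟩
    have hnn : 0 ≤ (d⁻¹ + ε) * D := by positivity
    by_cases hij : i = j
    · simpa [bad, hij] using hnn
    simp only [bad, hij, if_false, mul_add, sum_add_distrib, add_mul]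
    refine add_le_add ?_ ?_
    · refine (T.joint _ (hmem i) _ (hmem j) (by simpa using hij)
        (fun a b => if a = b then 1 else 0) fun a b => by split_ifs <;> norm_num).trans_eq ?_
      simp [hD]
    · by_cases h : H.Adj i j
      · simp only [h, if_true, mul_zero, sum_const_zero]; positivity
      · simp only [h, if_false]
        exact T.not_adj i (mem_univ _) j (mem_univ _) hij h
  have htotal : ∃ ω, T.weight ω ≠ 0 ∧ ∑ q, bad ω q < 1 := by
    by_contra! hcon
    have h1 : D ≤ ∑ ω, T.weight ω * ∑ q, bad ω q := by
      have : ∑ ω, T.weight ω * 1 = D := by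
        rw [T.marginal none none_mem_insertNone fun _ => 1]; simp [hD]
      rw [← this]
      refine sum_le_sum fun ω _ => ?_
      by_cases h : T.weight ω = 0
      · simp [h]
      · exact mul_le_mul_of_nonneg_left (hcon ω h) (T.weight_nonneg ω)
    have h2 : ∑ ω, T.weight ω * ∑ q, bad ω q ≤
        (Fintype.card W : ℝ) ^ 2 * ((d⁻¹ + ε) * D) := by
      simp_rw [mul_sum]
      rw [sum_comm]
      refine (sum_le_sum fun q _ => hbad q).trans_eq ?_
      rw [sum_const, card_univ, Fintype.card_prod, nsmul_eq_mul]
      push_cast; ring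
    nlinarith
  obtain ⟨ω, hω, hlt⟩ := htotal
  have hbad0 : ∀ q, 0 ≤ bad ω q := fun q => by
    dsimp only [bad]; split_ifs <;> norm_num
  have hgood : ∀ q, bad ω q < 1 := fun q =>
    (single_le_sum (fun q _ => hbad0 q) (mem_univ q)).trans_lt hlt
  have hinj : Function.Injective fun i => T.map ω (some i) := by
    intro i j hij
    by_contra hne
    have := hgood (i, j)
    simp only [bad, hne, if_false, hij, if_true] at this
    split_ifs at this <;> norm_num at this
  refine ⟨⟨⟨fun i => T.map ω (some i), hinj⟩, ?_⟩⟩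
  intro i j
  refine ⟨fun h => ?_, fun h => T.adj i (mem_univ _) j (mem_univ _) h ω hω⟩
  by_contra hn
  have hne : i ≠ j := fun e => h.ne (by rw [e])
  have h' : G.Adj (T.map ω (some i)) (T.map ω (some j)) := h
  have := hgood (i, j)
  simp only [bad, hne, hn, h', if_false, if_true] at this
  split_ifs at this <;> norm_num at this

end TreeWalk

/-! ### Choice of constants and reduction to large minimum degree. -/

/-- A graph of large minimum degree without `K_{s,t}` contains every small forest. -/
theorem IsAcyclic.isIndContained_of_degree {W V : Type*} [Fintype W] [Fintype V] [Nonempty V]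
    {H : SimpleGraph W} (hH : H.IsAcyclic) {G : SimpleGraph V} [DecidableRel G.Adj] {s t K m : ℕ}
    (hs : 0 < s) (ht : 0 < t) (hK : Fintype.card W ^ 2 < K) (hm : m = 8 * s * K)
    (hG : ∀ a, (4 * K * m * 2 ^ m * t : ℝ) ≤ G.degree a)
    (hst : ¬ (completeBipartiteGraph (Fin s) (Fin t)).IsContained G) : H.IsIndContained G := by
  classical
  have hK0 : 0 < K := by omega
  have hm0 : 0 < m := by rw [hm]; positivity
  have hK0' : (0 : ℝ) < K := by exact_mod_cast hK0
  have hm0' : (1 : ℝ) ≤ m := by exact_mod_cast hm0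
  have ht' : (1 : ℝ) ≤ t := by exact_mod_cast ht
  set d : ℝ := 4 * K * m * 2 ^ m * t with hd
  have hdm : 4 * K * (m : ℝ) ≤ d := by
    have h2 : (1 : ℝ) ≤ 2 ^ m := one_le_pow₀ (by norm_num)
    calc 4 * K * (m : ℝ) = 4 * K * m * 1 * 1 := by ring
      _ ≤ d := by rw [hd]; gcongr
  have hd0 : 0 < d := lt_of_lt_of_le (by positivity) hdm
  have hmd : m / d ≤ 1 / (4 * K) := by
    rw [div_le_div_iff₀ hd0 (by positivity)]; linarith
  have hid : d⁻¹ ≤ 1 / (4 * K) := by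
    refine le_trans ?_ hmd
    rw [inv_eq_one_div]
    gcongr
  have hheavy : ∀ c, #{a | (1 / (4 * K) : ℝ) * G.degree c ≤
      #{x ∈ G.neighborFinset c | G.Adj a x}} ≤ m := by
    intro c
    refine (card_lt_of_dense_to hs hst (δ := 1 / (4 * K)) (X := G.neighborFinset c) ?_ ?_ ?_).le
    · rw [hm]; push_cast
      rw [one_div, inv_mul_eq_div, le_div_iff₀ (by positivity)]
      linarith
    · rw [card_neighborFinset_eq_degree]
      have h : (4 * K * m * 2 ^ m * t : ℝ) ≤ G.degree c := hG c
      have : 4 * K * m * 2 ^ m * t ≤ G.degree c := by exact_mod_cast h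
      have hpos : 0 < m * 2 ^ m * t := by positivity
      nlinarith
    · intro u hu
      rw [card_neighborFinset_eq_degree]
      exact (mem_filter.1 hu).2
  -- With `δ = 1/(4K)`, `m = 8sK` gives `δm = 2s`. Since `m/d` and `1/d` are at most `1/(4K)`, the
  -- failure bound per pair is at most `3/(4K)`.
  obtain ⟨T⟩ := hH.nonempty_treeWalk (ε := 1 / (2 * K)) hd0 hG (δ := 1 / (4 * K)) (by positivity)
    (by
      have : (1 : ℝ) / (2 * K) = 1 / (4 * K) + 1 / (4 * K) := by field_simp; norm_num
      linarith) hheavy univ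
  refine T.isIndContained hd0 hG (by positivity) ?_
  have hcard : (Fintype.card W : ℝ) ^ 2 < K := by exact_mod_cast hK
  calc (Fintype.card W : ℝ) ^ 2 * (d⁻¹ + 1 / (2 * K))
      ≤ (Fintype.card W : ℝ) ^ 2 * (1 / K) := by
        gcongr
        have : (1 : ℝ) / K = 4 * (1 / (4 * K)) := by field_simp
        have : (1 : ℝ) / (2 * K) = 2 * (1 / (4 * K)) := by field_simp; norm_num
        have : (0 : ℝ) < 1 / (4 * K) := by positivity
        linarith
    _ < 1 := by rw [mul_one_div, div_lt_one hK0']; exact hcard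

theorem exists_induce_degree_ge {V : Type*} [Finite V] (G : SimpleGraph V)
    (hpos : 0 < G.degeneracy) :
    ∃ X : Set V, X.Nonempty ∧ ∀ v : X, (G.degeneracy : ℕ∞) ≤ ((G.induce X).neighborSet v).encard := by
  have h : ¬ G.IsDegenerate (G.degeneracy - 1) := fun h => by
    have : G.degeneracy ≤ G.degeneracy - 1 := Nat.sInf_le h
    omega
  unfold IsDegenerate at h
  push Not at h
  obtain ⟨K, hK, hdeg⟩ := h
  -- Inducing on the vertices of the witness only raises degrees.
  refine ⟨K.verts, hK, fun v => ?_⟩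
  have h1 : (G.degeneracy : ℕ∞) ≤ (K.neighborSet v).encard := by
    have := Order.add_one_le_of_lt (hdeg v v.2)
    rwa [← Nat.cast_one (R := ℕ∞), ← Nat.cast_add, Nat.sub_add_cancel hpos] at this
  refine h1.trans ?_
  rw [← Subtype.val_injective.encard_image ((G.induce K.verts).neighborSet v)]
  refine Set.encard_le_encard fun w hw => ?_
  exact ⟨⟨w, K.edge_vert hw.symm⟩, hw.adj_sub, rfl⟩

end SimpleGraph

theorem theorem1p6 {W : Type*} [Finite W] (H : SimpleGraph W) (hH : H.IsAcyclic)
    (s : ℕ) (hs : 0 < s) :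
    ∃ c : ℝ, 0 < c ∧
      ∀ {V : Type*} [Finite V] (G : SimpleGraph V) (t : ℕ), 0 < t →
        ¬ H.IsIndContained G →
        ¬ (completeBipartiteGraph (Fin s) (Fin t)).IsContained G →
        (G.degeneracy : ℝ) < c * t := by
  classical
  have := Fintype.ofFinite W
  obtain ⟨K, hK⟩ : ∃ K, Fintype.card W ^ 2 < K := ⟨_, Nat.lt_succ_self _⟩
  obtain ⟨m, hm⟩ : ∃ m, m = 8 * s * K := ⟨_, rfl⟩
  have hK0 : 0 < K := by omega
  have hm0 : 0 < m := by rw [hm]; positivity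
  refine ⟨4 * K * m * 2 ^ m, by positivity, fun {V} _ G t ht hind hbi => ?_⟩
  by_contra! hle
  have hpos : 0 < G.degeneracy := by
    have : (0 : ℝ) < 4 * K * m * 2 ^ m * t := by positivity
    exact_mod_cast this.trans_le hle
  obtain ⟨X, hX, hdeg⟩ := G.exists_induce_degree_ge hpos
  have := Fintype.ofFinite X
  have : Nonempty X := hX.to_subtype
  have hXG : (G.induce X).IsIndContained G := ⟨SimpleGraph.Embedding.induce X⟩
  refine hind ((hH.isIndContained_of_degree hs ht hK hm (fun a => hle.trans ?_)
    fun h => hbi (h.trans hXG.isContained)).trans hXG)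
  have h := hdeg a
  rw [← SimpleGraph.coe_neighborFinset, Set.encard_coe_eq_coe_finsetCard,
    SimpleGraph.card_neighborFinset_eq_degree] at h
  exact_mod_cast h
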